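/- Let the field of scalars be $\mathbb K=\mathbb R$ or $\mathbb K=\mathbb C$. For a topological space $X$ let $C_b(X)$ be the algebra of bounded continuous functions $f:X\to\mathbb K$ with the supremum norm, let $\mathrm{Coz}(f)=\{x:f(x)\neq 0\}$, and let $\mathrm{supp}(f)=\mathrm{cl}_X\mathrm{Coz}(f)$. Let $C_c(X)$ be the set of $f\in C_b(X)$ with compact support, and let $C_0(X)$ be the set of $f\in C_b(X)$ such that $\{x:|f(x)|\ge\varepsilon\}$ is compact for every $\varepsilon>0$. Let $\mathscr P$ be the Lindelöf property, and let $C_{\mathscr P}(X)$ be the set of $f\in C_b(X)$ such that $\mathrm{supp}(f)$ has a Lindelöf neighborhood in $X$. The Lindelöf number of $X$ is $$\ell(X)=\min\{\mathfrak n:\text{every open cover of }X\text{ has a subcover of cardinality}\le\mathfrak n\}+\aleph_0 .$$ For $X$ completely regular Hausdorff with Stone–Čech compactification $\beta X$ put $$\lambda_{\mathscr P}X=\bigcup\{\mathrm{int}_{\beta X}\mathrm{cl}_{\beta X}\mathrm{Coz}(f): f\in C_b(X),\ \mathrm{cl}_X\mathrm{Coz}(f)\text{ is Lindelöf}\}\subseteq\beta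 X .$$ Theorem. Let $X$ be a metrizable space in which every point has a Lindelöf neighborhood, and let $Y=\lambda_{\mathscr P}X$ with the subspace topology from $\beta X$. Then $C_{\mathscr P}(X)$ is a Banach subalgebra of $C_b(X)$ (that is, a subalgebra, not necessarily unital, complete in the supremum norm), $Y$ is locally compact Hausdorff, $C_{\mathscr P}(X)$ is isometrically isomorphic, as a normed algebra, to $C_c(Y)$, and every locally compact Hausdorff space $T$ such that $C_{\mathscr P}(X)$ is isometrically isomorphic to $C_c(T)$ is homeomorphic to $Y$. Moreover: 1. $C_{\mathscr P}(X)=\{f\in C_b(X):\mathrm{supp}(f)\text{ is Lindelöf}\}$. 2. $C_0(X)\subseteq C_{\mathscr P}(X)$, and the inclusion is proper if $X$ is not Lindelöf. 3. $C_c(Y)=C_0(Y)$. 4. $Y$ is countably compact. 5. If $X$ is not Lindelöf, then $Y$ is not normal. 6. If $X$ is infinite, then $\dim C_{\mathscr P}(X)=\ell(X)^{\aleph_0}$, where $\dim$ is the (algebraic) vector space dimension over $\mathbb K$. -/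

import Mathlib

open Set Topology BoundedContinuousFunction
open scoped Cardinal

universe u v

/-- Every point has a Lindelöf neighborhood (not necessarily open or closed). -/
def IsLocallyLindelof (X : Type u) [TopologicalSpace X] : Prop :=
  ∀ x : X, ∃ U ∈ 𝓝 x, IsLindelof U

section Algebras

variable (𝕜 : Type) [RCLike 𝕜] (X : Type u) [TopologicalSpace X]

/-- `C_𝒫(X)` for `𝒫` the Lindelöf property: the bounded continuous scalar-valued functions whose
support (the closure of the cozero-set) has a Lindelöf neighborhood, as a (not necessarily unital)
subalgebra of `C_b(X)`. -/
def lindelofSupported : NonUnitalSubalgebra 𝕜 (X →ᵇ 𝕜) where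
  carrier := {f | ∃ U ∈ 𝓝ˢ (tsupport f), IsLindelof U}
  zero_mem' := ⟨∅, by simp [tsupport], isLindelof_empty⟩
  add_mem' := by
    rintro f g ⟨U, hU, hUL⟩ ⟨V, hV, hVL⟩
    refine ⟨U ∪ V, ?_, hUL.union hVL⟩
    exact nhdsSet_mono (tsupport_add (⇑f) (⇑g)) (union_mem_nhdsSet hU hV)
  mul_mem' := by
    rintro f g ⟨U, hU, hUL⟩ -
    exact ⟨U, nhdsSet_mono (tsupport_mul_subset_left (f := ⇑f) (g := ⇑g)) hU, hUL⟩
  smul_mem' := by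
    rintro c f ⟨U, hU, hUL⟩
    exact ⟨U, nhdsSet_mono (tsupport_smul_subset_right (fun _ => c) (⇑f)) hU, hUL⟩

/-- `C_c(X)`: the bounded continuous functions with compact support, as a subalgebra of `C_b(X)`
(with the supremum norm). -/
def compactSupported : NonUnitalSubalgebra 𝕜 (X →ᵇ 𝕜) where
  carrier := {f | IsCompact (tsupport f)}
  zero_mem' := by simp [tsupport]
  add_mem' := by
    intro f g hf hg
    exact (hf.union hg).of_isClosed_subset (isClosed_tsupport _) (tsupport_add (⇑f) (⇑g))
  mul_mem' := by
    intro f g hf _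
    exact hf.of_isClosed_subset (isClosed_tsupport _)
      (tsupport_mul_subset_left (f := ⇑f) (g := ⇑g))
  smul_mem' := by
    intro c f hf
    exact hf.of_isClosed_subset (isClosed_tsupport _)
      (tsupport_smul_subset_right (fun _ => c) (⇑f))

/-- `C_0(X)`: the bounded continuous functions vanishing at infinity. -/
def vanishingAtInfinity : Set (X →ᵇ 𝕜) :=
  {f | ∀ ε : ℝ, 0 < ε → IsCompact {x | ε ≤ ‖f x‖}}

/-- `λ_𝒫 X` for `𝒫` the Lindelöf property: the union of the sets `int cl C` (interior and closure
taken in the Stone–Čech compactification `βX`) over all cozero-sets `C` of `X` whose closure in `X`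
is Lindelöf. -/
def lambdaLindelof : Set (StoneCech X) :=
  ⋃ f ∈ {f : X →ᵇ 𝕜 | IsLindelof (closure (Function.support f))},
    interior (closure (stoneCechUnit '' Function.support f))

end Algebras

/-- Two (not necessarily unital) normed `𝕜`-algebras are isometrically isomorphic: there is a
norm-preserving bijective algebra homomorphism between them. -/
def IsometricallyIsomorphic (𝕜 : Type) [RCLike 𝕜] (A : Type u) (B : Type v)
    [NonUnitalNormedRing A] [Module 𝕜 A] [NonUnitalNormedRing B] [Module 𝕜 B] : Prop :=
  ∃ φ : A →ₙₐ[𝕜] B, Function.Bijective φ ∧ ∀ a : A, ‖φ a‖ = ‖a‖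

/-- The Lindelöf number `ℓ(X)`: the least cardinal `n` such that every open cover of `X` has a
subcover of cardinality at most `n`, plus `ℵ₀`. -/
noncomputable def lindelofNumber (X : Type u) [TopologicalSpace X] : Cardinal.{u} :=
  sInf {n : Cardinal.{u} | ∀ 𝒰 : Set (Set X), (∀ U ∈ 𝒰, IsOpen U) → ⋃₀ 𝒰 = univ →
    ∃ 𝒱 ⊆ 𝒰, ⋃₀ 𝒱 = univ ∧ #𝒱 ≤ n} + ℵ₀

/-!
By paracompactness `X` splits into clopen Lindelöf pieces; let `p : X → I` send a point to the index
of its piece. A subset of `X` has Lindelöf closure exactly when it meets countably many pieces, so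
`C_𝒫(X)` consists of the functions vanishing off countably many pieces. Extend `p` to a map from
`βX` to the ultrafilters on `I`: then `λX` consists of the points whose ultrafilter contains a
countable set, and every countable union of pieces has a compact open closure in `λX`. Hence
restriction to `X` maps `C_c(λX)` isometrically onto `C_𝒫(X)`. The space `T` is recovered from
`C_c(T)` since the surjective characters of `C_c(T)` are the evaluations at points.

If `I` is uncountable, the ultrafilters on an uncountable family of copies of a countable set of
indices supply points of `λX` that behave like those of `ω₁ × (ω₁ + 1)`, whose diagonal and right
edge cannot be separated. The dimension is the cardinality: a vector space over `𝕜` of dimension at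
least `𝔠` has as many elements as its dimension.
-/

section PartitionExistence

/-- The equivalence relation generated by lying in a common member of the family `v`. -/
def overlapSetoid {α ι : Type*} (v : ι → Set α) : Setoid α :=
  Relation.EqvGen.setoid fun x y => ∃ i, x ∈ v i ∧ y ∈ v i

theorem mem_iff_mem_of_overlapSetoid {α ι : Type*} {v : ι → Set α} {M : Set α}
    (hM : ∀ i, (v i ∩ M).Nonempty → v i ⊆ M) {x y : α} (h : overlapSetoid v x y) :
    x ∈ M ↔ y ∈ M := by
  induction h with
  | rel x y h =>
    obtain ⟨i, hx, hy⟩ := h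
    exact ⟨fun hxM => hM i ⟨x, hx, hxM⟩ hy, fun hyM => hM i ⟨y, hy, hyM⟩ hx⟩
  | refl => exact Iff.rfl
  | symm _ _ _ ih => exact ih.symm
  | trans _ _ _ _ _ ih₁ ih₂ => exact ih₁.trans ih₂

variable {X ι : Type*} [TopologicalSpace X] {v : ι → Set X}

theorem isLocallyConstant_mk_overlapSetoid (hvo : ∀ i, IsOpen (v i)) (hvc : ⋃ i, v i = univ) :
    IsLocallyConstant (Quotient.mk (overlapSetoid v)) := by
  refine (IsLocallyConstant.iff_exists_open _).2 fun x => ?_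
  obtain ⟨i, hx⟩ := iUnion_eq_univ_iff.1 hvc x
  exact ⟨v i, hvo i, hx, fun y hy => Quotient.sound (.rel _ _ ⟨i, hy, hx⟩)⟩

theorem countable_inter_nonempty_of_locallyFinite (hv : LocallyFinite v) {S : Set X}
    (hS : IsLindelof S) : {i | (v i ∩ S).Nonempty}.Countable := by
  choose U hU hUf using hv
  obtain ⟨t, ht, -, hSt⟩ := hS.elim_nhds_subcover U fun x _ => hU x
  refine (ht.biUnion fun x _ => (hUf x).countable).mono ?_
  rintro i ⟨y, hyi, hyS⟩
  obtain ⟨x, hx, hyx⟩ := mem_iUnion₂.1 (hSt hyS)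
  exact mem_biUnion hx ⟨y, hyi, hyx⟩

theorem exists_isLindelof_saturated (hv : LocallyFinite v) {L : ι → Set X}
    (hL : ∀ i, IsLindelof (L i)) (hvL : ∀ i, v i ⊆ L i) (x : X) :
    ∃ M : Set X, IsLindelof M ∧ x ∈ M ∧ ∀ i, (v i ∩ M).Nonempty → v i ⊆ M := by
  let S : ℕ → Set X := fun n => n.rec {x} fun _ T => ⋃ i ∈ {i | (v i ∩ T).Nonempty}, L i
  have hS : ∀ n, IsLindelof (S n) := by
    intro n
    induction n with
    | zero => exact isLindelof_singleton
    | succ n ih =>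
      exact (countable_inter_nonempty_of_locallyFinite hv ih).isLindelof_biUnion fun i _ => hL i
  refine ⟨⋃ n, S n, isLindelof_iUnion hS, mem_iUnion.2 ⟨0, rfl⟩, ?_⟩
  rintro i ⟨y, hyi, hy⟩
  obtain ⟨n, hyn⟩ := mem_iUnion.1 hy
  have hi : i ∈ {i | (v i ∩ S n).Nonempty} := ⟨y, hyi, hyn⟩
  exact ((hvL i).trans (subset_biUnion_of_mem hi)).trans (subset_iUnion S (n + 1))

/-- A partition of a space into nonempty clopen Lindelöf sets, encoded as the map `p` that sends a
point to the index of its piece. -/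
structure IsLindelofPartition {I : Type*} (p : X → I) : Prop where
  surjective : Function.Surjective p
  isLocallyConstant : IsLocallyConstant p
  isLindelof_fiber : ∀ i, IsLindelof (p ⁻¹' {i})

theorem isLindelofPartition_mk_overlapSetoid (hvo : ∀ i, IsOpen (v i)) (hvc : ⋃ i, v i = univ)
    (hv : LocallyFinite v) {L : ι → Set X} (hL : ∀ i, IsLindelof (L i)) (hvL : ∀ i, v i ⊆ L i) :
    IsLindelofPartition (Quotient.mk (overlapSetoid v)) := by
  have hp := isLocallyConstant_mk_overlapSetoid hvo hvc
  refine ⟨Quotient.mk_surjective, hp, Quotient.mk_surjective.forall.2 fun x => ?_⟩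
  obtain ⟨M, hM, hxM, hsat⟩ := exists_isLindelof_saturated hv hL hvL x
  exact hM.of_isClosed_subset (hp.isClosed_fiber _) fun y hy =>
    (mem_iff_mem_of_overlapSetoid hsat (Quotient.exact hy)).2 hxM

theorem IsLocallyLindelof.exists_isLindelofPartition {X : Type u} [TopologicalSpace X]
    [ParacompactSpace X] (hX : IsLocallyLindelof X) :
    ∃ (I : Type u) (p : X → I), IsLindelofPartition p := by
  choose L hLx hL using hX
  obtain ⟨v, hvo, hvc, hv, hvL⟩ := precise_refinement (fun x => interior (L x))
    (fun _ => isOpen_interior)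
    (iUnion_eq_univ_iff.2 fun x => ⟨x, mem_interior_iff_mem_nhds.2 (hLx x)⟩)
  exact ⟨_, _, isLindelofPartition_mk_overlapSetoid hvo hvc hv hL
    fun x => (hvL x).trans interior_subset⟩

end PartitionExistence

namespace IsLindelofPartition

section Pieces

variable {X I : Type*} [TopologicalSpace X] {p : X → I}

theorem isClopen_preimage (hp : IsLindelofPartition p) (J : Set I) : IsClopen (p ⁻¹' J) :=
  ⟨isOpen_compl_iff.1 (hp.isLocallyConstant Jᶜ), hp.isLocallyConstant J⟩

theorem isLindelof_preimage (hp : IsLindelofPartition p) {J : Set I} (hJ : J.Countable) :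
    IsLindelof (p ⁻¹' J) := by
  rw [← biUnion_preimage_singleton]
  exact hJ.isLindelof_biUnion fun i _ => hp.isLindelof_fiber i

theorem countable_image (hp : IsLindelofPartition p) {S : Set X} (hS : IsLindelof S) :
    (p '' S).Countable := by
  let _ : TopologicalSpace I := ⊥
  have : DiscreteTopology I := ⟨rfl⟩
  exact (hS.image hp.isLocallyConstant.continuous).countable inferInstance

theorem isLindelof_closure_iff (hp : IsLindelofPartition p) {S : Set X} :
    IsLindelof (closure S) ↔ (p '' S).Countable := by
  constructor
  · exact fun h => (hp.countable_image h).mono (image_mono subset_closure)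
  · exact fun h => (hp.isLindelof_preimage h).of_isClosed_subset isClosed_closure
      (closure_minimal (subset_preimage_image p S) (hp.isClopen_preimage _).1)

theorem uncountable (hp : IsLindelofPartition p) (hX : ¬ LindelofSpace X) : Uncountable I := by
  rw [← not_countable_iff]
  intro h
  exact hX (isLindelof_univ_iff.1 (hp.isLindelof_preimage (countable_univ (α := I))))

/-- The `𝕜`-valued indicator function of a union of pieces of the partition. -/
noncomputable def indicator (hp : IsLindelofPartition p) (𝕜 : Type*) [RCLike 𝕜] (J : Set I) :
    X →ᵇ 𝕜 :=
  .ofNormedAddCommGroup (fun x => J.indicator 1 (p x))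
    (hp.isLocallyConstant.comp (J.indicator 1)).continuous 1
    fun x => (norm_indicator_le_norm_self _ _).trans (by simp)

theorem support_indicator (hp : IsLindelofPartition p) (𝕜 : Type*) [RCLike 𝕜] (J : Set I) :
    Function.support (hp.indicator 𝕜 J) = p ⁻¹' J := by
  ext x
  by_cases hx : p x ∈ J <;> simp [indicator, hx]

end Pieces

section StoneCech

variable {X : Type u} {I : Type*} [TopologicalSpace X] {p : X → I}

/-- The continuous extension of `p` to the Stone–Čech compactification; its values are ultrafilters
on the discrete set `I`, that is, points of `βI`. -/
noncomputable def extend (hp : IsLindelofPartition p) : StoneCech X → Ultrafilter I :=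
  stoneCechExtend (hp.isLocallyConstant.comp (pure : I → Ultrafilter I)).continuous

theorem continuous_extend (hp : IsLindelofPartition p) : Continuous hp.extend :=
  continuous_stoneCechExtend _

@[simp]
theorem extend_stoneCechUnit (hp : IsLindelofPartition p) (x : X) :
    hp.extend (stoneCechUnit x) = pure (p x) :=
  stoneCechExtend_stoneCechUnit _ x

theorem extend_surjective (hp : IsLindelofPartition p) : Function.Surjective hp.extend := by
  rw [← range_eq_univ, ← univ_subset_iff, ← (denseRange_pure (α := I)).closure_range]
  refine closure_minimal ?_ (isCompact_range hp.continuous_extend).isClosed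
  rintro _ ⟨i, rfl⟩
  obtain ⟨x, rfl⟩ := hp.surjective i
  exact ⟨stoneCechUnit x, hp.extend_stoneCechUnit x⟩

theorem isClopen_setOf_mem_extend (hp : IsLindelofPartition p) (J : Set I) :
    IsClopen {y | J ∈ hp.extend y} :=
  ⟨(ultrafilter_isClosed_basic J).preimage hp.continuous_extend,
    (ultrafilter_isOpen_basic J).preimage hp.continuous_extend⟩

theorem closure_image_preimage (hp : IsLindelofPartition p) (J : Set I) :
    closure (stoneCechUnit '' (p ⁻¹' J)) = {y | J ∈ hp.extend y} := by
  have himage : stoneCechUnit '' (p ⁻¹' J) = {y | J ∈ hp.extend y} ∩ range stoneCechUnit := by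
    rw [← image_preimage_eq_inter_range]
    congr 1 with x
    simp
  refine Subset.antisymm ?_ fun y hy => ?_
  · exact closure_minimal (himage ▸ inter_subset_left) (hp.isClopen_setOf_mem_extend J).1
  · rw [himage]
    exact (hp.isClopen_setOf_mem_extend J).2.inter_closure ⟨hy, denseRange_stoneCechUnit y⟩

end StoneCech

section Lambda

variable {X : Type u} {I : Type*} [TopologicalSpace X] {p : X → I} (𝕜 : Type) [RCLike 𝕜]

theorem lambdaLindelof_eq (hp : IsLindelofPartition p) :
    lambdaLindelof 𝕜 X = {y | ∃ J : Set I, J.Countable ∧ J ∈ hp.extend y} := by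
  ext y
  simp only [lambdaLindelof, mem_iUnion, mem_ofPred_eq, exists_prop]
  constructor
  · rintro ⟨f, hf, hy⟩
    refine ⟨p '' Function.support f, hp.isLindelof_closure_iff.1 hf, ?_⟩
    have hyf := closure_mono (image_mono (subset_preimage_image p _)) (interior_subset hy)
    rwa [hp.closure_image_preimage] at hyf
  · rintro ⟨J, hJ, hy⟩
    refine ⟨hp.indicator 𝕜 J, ?_, ?_⟩
    · rw [hp.support_indicator, (hp.isClopen_preimage J).1.closure_eq]
      exact hp.isLindelof_preimage hJ
    · rw [hp.support_indicator, hp.closure_image_preimage,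
        (hp.isClopen_setOf_mem_extend J).2.interior_eq]
      exact hy

theorem stoneCechUnit_mem_lambdaLindelof (hp : IsLindelofPartition p) (x : X) :
    stoneCechUnit x ∈ lambdaLindelof 𝕜 X := by
  rw [hp.lambdaLindelof_eq 𝕜]
  exact ⟨{p x}, countable_singleton _, by simp⟩

/-- The canonical map of `X` into `λX`, a restriction of the map of `X` into `βX`. -/
noncomputable def toLambda (hp : IsLindelofPartition p) : C(X, lambdaLindelof 𝕜 X) where
  toFun x := ⟨stoneCechUnit x, hp.stoneCechUnit_mem_lambdaLindelof 𝕜 x⟩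
  continuous_toFun := continuous_stoneCechUnit.subtype_mk _

/-- The trace on `λX` of the closure in `βX` of the union of the pieces indexed by `J`. -/
def block (hp : IsLindelofPartition p) (J : Set I) : Set (lambdaLindelof 𝕜 X) :=
  {y | J ∈ hp.extend y}

theorem toLambda_mem_block (hp : IsLindelofPartition p) {x : X} {J : Set I} :
    hp.toLambda 𝕜 x ∈ hp.block 𝕜 J ↔ p x ∈ J := by
  simp [toLambda, block]

theorem block_mono (hp : IsLindelofPartition p) {J K : Set I} (h : J ⊆ K) :
    hp.block 𝕜 J ⊆ hp.block 𝕜 K :=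
  fun _ hy => Filter.mem_of_superset hy h

theorem compl_block (hp : IsLindelofPartition p) (J : Set I) :
    (hp.block 𝕜 J)ᶜ = hp.block 𝕜 Jᶜ := by
  ext y
  exact Ultrafilter.compl_mem_iff_notMem.symm

theorem isClopen_block (hp : IsLindelofPartition p) (J : Set I) : IsClopen (hp.block 𝕜 J) :=
  (hp.isClopen_setOf_mem_extend J).preimage continuous_subtype_val

theorem closure_toLambda_image (hp : IsLindelofPartition p) (J : Set I) :
    closure (hp.toLambda 𝕜 '' (p ⁻¹' J)) = hp.block 𝕜 J := by
  rw [IsInducing.subtypeVal.closure_eq_preimage_closure_image, image_image]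
  exact congrArg (Subtype.val ⁻¹' ·) (hp.closure_image_preimage J)

theorem denseRange_toLambda (hp : IsLindelofPartition p) : DenseRange (hp.toLambda 𝕜) := by
  have h := hp.closure_toLambda_image 𝕜 univ
  rw [preimage_univ, image_univ] at h
  exact dense_iff_closure_eq.2 (h.trans (eq_univ_of_forall fun _ => Filter.univ_mem))

theorem isCompact_block (hp : IsLindelofPartition p) {J : Set I} (hJ : J.Countable) :
    IsCompact (hp.block 𝕜 J) := by
  have hsub : {y | J ∈ hp.extend y} ⊆ range (Subtype.val : lambdaLindelof 𝕜 X → StoneCech X) := by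
    rw [Subtype.range_coe, hp.lambdaLindelof_eq 𝕜]
    exact fun y hy => ⟨J, hJ, hy⟩
  exact IsInducing.subtypeVal.isCompact_preimage' (hp.isClopen_setOf_mem_extend J).1.isCompact hsub

theorem exists_countable_mem_block (hp : IsLindelofPartition p) (y : lambdaLindelof 𝕜 X) :
    ∃ J : Set I, J.Countable ∧ y ∈ hp.block 𝕜 J :=
  (hp.lambdaLindelof_eq 𝕜).subset y.2

theorem exists_countable_subset_block (hp : IsLindelofPartition p) {K : Set (lambdaLindelof 𝕜 X)}
    (hK : IsLindelof K) : ∃ J : Set I, J.Countable ∧ K ⊆ hp.block 𝕜 J := by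
  choose J hJ hJm using hp.exists_countable_mem_block 𝕜
  obtain ⟨t, ht, -, hKt⟩ := hK.elim_nhds_subcover (fun y => hp.block 𝕜 (J y))
    fun y _ => (hp.isClopen_block 𝕜 (J y)).2.mem_nhds (hJm y)
  exact ⟨⋃ y ∈ t, J y, ht.biUnion fun y _ => hJ y,
    hKt.trans (iUnion₂_subset fun y hy => hp.block_mono 𝕜 (subset_biUnion_of_mem hy))⟩

theorem countablyCompactSpace_lambdaLindelof (hp : IsLindelofPartition p) :
    CountablyCompactSpace (lambdaLindelof 𝕜 X) := by
  refine ⟨isCountablyCompact_iff_seq_clusterPt.2 fun y _ => ?_⟩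
  obtain ⟨J, hJ, hyJ⟩ := hp.exists_countable_subset_block 𝕜 (countable_range y).isLindelof
  obtain ⟨a, -, ha⟩ := (hp.isCompact_block 𝕜 hJ).isCountablyCompact.seq_clusterPt y
    (.of_forall fun n => hyJ (mem_range_self n))
  exact ⟨a, mem_univ a, ha⟩

end Lambda

end IsLindelofPartition

theorem isOpen_lambdaLindelof (𝕜 : Type) [RCLike 𝕜] (X : Type u) [TopologicalSpace X] :
    IsOpen (lambdaLindelof 𝕜 X) :=
  isOpen_biUnion fun _ _ => isOpen_interior

instance (𝕜 : Type) [RCLike 𝕜] (X : Type u) [TopologicalSpace X] :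
    LocallyCompactSpace (lambdaLindelof 𝕜 X) :=
  (isOpen_lambdaLindelof 𝕜 X).locallyCompactSpace

section VanishingAtInfinity

theorem support_eq_iUnion_le_norm {E Z : Type*} [NormedAddGroup E] (f : Z → E) :
    Function.support f = ⋃ n : ℕ, {x | 1 / ((n : ℝ) + 1) ≤ ‖f x‖} := by
  ext x
  simp only [Function.mem_support, mem_iUnion, mem_ofPred_eq]
  constructor
  · intro hx
    obtain ⟨n, hn⟩ := exists_nat_one_div_lt (norm_pos_iff.2 hx)
    exact ⟨n, hn.le⟩
  · rintro ⟨n, hn⟩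
    exact norm_pos_iff.1 (Nat.one_div_pos_of_nat.trans_le hn)

variable {𝕜 : Type} [RCLike 𝕜] {X : Type u} [TopologicalSpace X]

theorem isLindelof_support_of_mem_vanishingAtInfinity {f : X →ᵇ 𝕜}
    (hf : f ∈ vanishingAtInfinity 𝕜 X) : IsLindelof (Function.support f) := by
  rw [support_eq_iUnion_le_norm]
  exact isLindelof_iUnion fun n => (hf _ Nat.one_div_pos_of_nat).isLindelof

variable (𝕜 X)

theorem compactSupported_subset_vanishingAtInfinity :
    (compactSupported 𝕜 X : Set (X →ᵇ 𝕜)) ⊆ vanishingAtInfinity 𝕜 X := by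
  intro f hf ε hε
  refine IsCompact.of_isClosed_subset hf (isClosed_le continuous_const f.continuous.norm) ?_
  exact fun x hx => subset_tsupport _ (norm_pos_iff.1 (hε.trans_le hx))

end VanishingAtInfinity

theorem exists_stoneCech_extension {X E : Type*} [TopologicalSpace X] [MetricSpace E]
    [ProperSpace E] (f : X →ᵇ E) : ∃ g : StoneCech X →ᵇ E, ∀ x, g (stoneCechUnit x) = f x := by
  have : CompactSpace (closure (range f)) :=
    isCompact_iff_compactSpace.1 f.isBounded_range.isCompact_closure
  have hf : Continuous fun x => (⟨f x, subset_closure (mem_range_self x)⟩ : closure (range f)) :=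
    f.continuous.subtype_mk _
  refine ⟨mkOfCompact ⟨fun y => ((stoneCechExtend hf y : closure (range f)) : E),
    continuous_subtype_val.comp (continuous_stoneCechExtend hf)⟩, fun x => ?_⟩
  exact congrArg Subtype.val (stoneCechExtend_stoneCechUnit hf x)

namespace IsLindelofPartition

variable {𝕜 : Type} [RCLike 𝕜] {X : Type u} {I : Type*} [TopologicalSpace X] {p : X → I}

theorem mem_lindelofSupported_iff_countable (hp : IsLindelofPartition p) {f : X →ᵇ 𝕜} :
    f ∈ lindelofSupported 𝕜 X ↔ (p '' Function.support f).Countable := by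
  rw [← hp.isLindelof_closure_iff]
  constructor
  · rintro ⟨U, hU, hUL⟩
    exact hUL.of_isClosed_subset isClosed_closure (subset_of_mem_nhdsSet hU)
  · intro h
    refine ⟨p ⁻¹' (p '' tsupport f), ?_, hp.isLindelof_preimage (hp.countable_image h)⟩
    exact (hp.isClopen_preimage _).2.mem_nhdsSet.2 (subset_preimage_image p _)

theorem mem_lindelofSupported_iff (hp : IsLindelofPartition p) {f : X →ᵇ 𝕜} :
    f ∈ lindelofSupported 𝕜 X ↔ ∃ J : Set I, J.Countable ∧ Function.support f ⊆ p ⁻¹' J := by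
  rw [hp.mem_lindelofSupported_iff_countable]
  exact ⟨fun h => ⟨_, h, subset_preimage_image p _⟩,
    fun ⟨_, hJ, h⟩ => hJ.mono (image_subset_iff.2 h)⟩

theorem indicator_mem_lindelofSupported (hp : IsLindelofPartition p) {J : Set I}
    (hJ : J.Countable) : hp.indicator 𝕜 J ∈ lindelofSupported 𝕜 X :=
  hp.mem_lindelofSupported_iff.2 ⟨J, hJ, (hp.support_indicator 𝕜 J).subset⟩

variable (𝕜)

theorem lindelofSupported_eq (hp : IsLindelofPartition p) :
    (lindelofSupported 𝕜 X : Set (X →ᵇ 𝕜)) = {f : X →ᵇ 𝕜 | IsLindelof (tsupport f)} := by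
  ext f
  exact hp.mem_lindelofSupported_iff_countable.trans hp.isLindelof_closure_iff.symm

theorem vanishingAtInfinity_subset (hp : IsLindelofPartition p) :
    vanishingAtInfinity 𝕜 X ⊆ (lindelofSupported 𝕜 X : Set (X →ᵇ 𝕜)) := fun _ hf =>
  hp.mem_lindelofSupported_iff_countable.2
    (hp.countable_image (isLindelof_support_of_mem_vanishingAtInfinity hf))

theorem finite_of_indicator_mem_vanishingAtInfinity (hp : IsLindelofPartition p) {J : Set I}
    (h : hp.indicator 𝕜 J ∈ vanishingAtInfinity 𝕜 X) : J.Finite := by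
  have hJ : {x | 1 ≤ ‖hp.indicator 𝕜 J x‖} = p ⁻¹' J := by
    ext x
    by_cases hx : p x ∈ J <;> simp [indicator, hx]
  let _ : TopologicalSpace I := ⊥
  have : DiscreteTopology I := ⟨rfl⟩
  have himage := (hJ ▸ h 1 one_pos).image hp.isLocallyConstant.continuous
  rw [image_preimage_eq J hp.surjective] at himage
  exact isCompact_iff_finite.1 himage

theorem vanishingAtInfinity_ssubset (hp : IsLindelofPartition p) (hX : ¬ LindelofSpace X) :
    vanishingAtInfinity 𝕜 X ⊂ (lindelofSupported 𝕜 X : Set (X →ᵇ 𝕜)) := by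
  have := hp.uncountable hX
  refine ⟨hp.vanishingAtInfinity_subset 𝕜, fun h => ?_⟩
  have hinf := infinite_range_of_injective (Infinite.natEmbedding I).injective
  exact hinf (hp.finite_of_indicator_mem_vanishingAtInfinity 𝕜
    (h (hp.indicator_mem_lindelofSupported (countable_range _))))

theorem completeSpace_lindelofSupported (hp : IsLindelofPartition p) :
    CompleteSpace (lindelofSupported 𝕜 X) := by
  suffices h : IsClosed (lindelofSupported 𝕜 X : Set (X →ᵇ 𝕜)) from h.completeSpace_coe
  refine IsSeqClosed.isClosed fun f g hf hfg => ?_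
  choose J hJ hfJ using fun n => hp.mem_lindelofSupported_iff.1 (hf n)
  refine hp.mem_lindelofSupported_iff.2
    ⟨⋃ n, J n, countable_iUnion hJ, Function.support_subset_iff'.2 fun x hx => ?_⟩
  have hlim : Filter.Tendsto (fun n => f n x) Filter.atTop (𝓝 (g x)) :=
    ((continuous_eval_const x).tendsto g).comp hfg
  have hzero : ∀ n, f n x = 0 := fun n =>
    Function.support_subset_iff'.1 (hfJ n) x fun h => hx (mem_iUnion.2 ⟨n, h⟩)
  simp only [hzero] at hlim
  exact tendsto_nhds_unique hlim tendsto_const_nhds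

theorem mem_compactSupported_of_support_subset_block (hp : IsLindelofPartition p)
    {f : lambdaLindelof 𝕜 X →ᵇ 𝕜} {J : Set I} (hJ : J.Countable)
    (hf : Function.support f ⊆ hp.block 𝕜 J) : f ∈ compactSupported 𝕜 (lambdaLindelof 𝕜 X) :=
  (hp.isCompact_block 𝕜 hJ).of_isClosed_subset isClosed_closure
    (closure_minimal hf (hp.isClopen_block 𝕜 J).1)

theorem compactSupported_lambdaLindelof_eq (hp : IsLindelofPartition p) :
    (compactSupported 𝕜 (lambdaLindelof 𝕜 X) : Set (lambdaLindelof 𝕜 X →ᵇ 𝕜)) =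
      vanishingAtInfinity 𝕜 (lambdaLindelof 𝕜 X) := by
  refine (compactSupported_subset_vanishingAtInfinity 𝕜 _).antisymm fun f hf => ?_
  obtain ⟨J, hJ, hfJ⟩ := hp.exists_countable_subset_block 𝕜
    (isLindelof_support_of_mem_vanishingAtInfinity hf)
  exact hp.mem_compactSupported_of_support_subset_block 𝕜 hJ hfJ

theorem compContinuous_toLambda_mem (hp : IsLindelofPartition p) {f : lambdaLindelof 𝕜 X →ᵇ 𝕜}
    (hf : f ∈ compactSupported 𝕜 (lambdaLindelof 𝕜 X)) :
    f.compContinuous (hp.toLambda 𝕜) ∈ lindelofSupported 𝕜 X := by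
  obtain ⟨J, hJ, hfJ⟩ := hp.exists_countable_subset_block 𝕜 (IsCompact.isLindelof hf)
  exact hp.mem_lindelofSupported_iff.2
    ⟨J, hJ, fun x hx => (hp.toLambda_mem_block 𝕜).1 (hfJ (subset_tsupport _ hx))⟩

/-- The restriction of functions from `λX` to `X`, as a homomorphism `C_c(λX) → C_𝒫(X)`. -/
noncomputable def restrictHom (hp : IsLindelofPartition p) :
    compactSupported 𝕜 (lambdaLindelof 𝕜 X) →ₙₐ[𝕜] lindelofSupported 𝕜 X where
  toFun f := ⟨f.1.compContinuous (hp.toLambda 𝕜), hp.compContinuous_toLambda_mem 𝕜 f.2⟩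
  map_smul' _ _ := rfl
  map_zero' := rfl
  map_add' _ _ := rfl
  map_mul' _ _ := rfl

theorem norm_restrictHom (hp : IsLindelofPartition p)
    (f : compactSupported 𝕜 (lambdaLindelof 𝕜 X)) : ‖hp.restrictHom 𝕜 f‖ = ‖f‖ := by
  apply le_antisymm
  · exact (norm_le (norm_nonneg _)).2 fun x => f.1.norm_coe_le_norm _
  · refine (norm_le (norm_nonneg _)).2 fun y => ?_
    refine (hp.denseRange_toLambda 𝕜).induction_on y
      (isClosed_le f.1.continuous.norm continuous_const) fun x => ?_
    exact (hp.restrictHom 𝕜 f).1.norm_coe_le_norm x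

theorem restrictHom_surjective (hp : IsLindelofPartition p) :
    Function.Surjective (hp.restrictHom 𝕜) := by
  rintro ⟨f, hf⟩
  obtain ⟨J, hJ, hfJ⟩ := hp.mem_lindelofSupported_iff.1 hf
  obtain ⟨g, hg⟩ := exists_stoneCech_extension f
  let gL : lambdaLindelof 𝕜 X →ᵇ 𝕜 := g.compContinuous ⟨_, continuous_subtype_val⟩
  have hzero : hp.block 𝕜 Jᶜ ⊆ {y | gL y = 0} := by
    rw [← hp.closure_toLambda_image 𝕜]
    refine closure_minimal ?_ (isClosed_eq gL.continuous continuous_const)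
    rintro _ ⟨x, hx, rfl⟩
    exact (hg x).trans (Function.support_subset_iff'.1 hfJ x hx)
  have hgL : Function.support gL ⊆ hp.block 𝕜 J :=
    Function.support_subset_iff'.2 fun y hy => hzero (hp.compl_block 𝕜 J ▸ hy)
  exact ⟨⟨gL, hp.mem_compactSupported_of_support_subset_block 𝕜 hJ hgL⟩,
    Subtype.ext (BoundedContinuousFunction.ext hg)⟩

theorem bijective_restrictHom (hp : IsLindelofPartition p) :
    Function.Bijective (hp.restrictHom 𝕜) :=
  ⟨(AddMonoidHomClass.isometry_of_norm _ (hp.norm_restrictHom 𝕜)).injective,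
    hp.restrictHom_surjective 𝕜⟩

theorem isometricallyIsomorphic_compactSupported (hp : IsLindelofPartition p) :
    IsometricallyIsomorphic 𝕜 (lindelofSupported 𝕜 X)
      (compactSupported 𝕜 (lambdaLindelof 𝕜 X)) := by
  obtain ⟨g, hleft, hright⟩ := Function.bijective_iff_has_inverse.1 (hp.bijective_restrictHom 𝕜)
  refine ⟨(hp.restrictHom 𝕜).inverse g hleft hright,
    ⟨hright.injective, hleft.surjective⟩, fun a => ?_⟩
  rw [← hp.norm_restrictHom 𝕜]
  exact congrArg norm (hright a)

end IsLindelofPartition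

section BanachStone

theorem eq_of_forall_eq_zero_imp {K A : Type*} [Field K] [NonUnitalNonAssocRing A] [Module K A]
    {χ ψ : A →ₙₐ[K] K} {a : A} (ha : ψ a ≠ 0) (h : ∀ b, χ b = 0 → ψ b = 0) : χ = ψ := by
  have hχa : χ a ≠ 0 := mt (h a) ha
  have hprop : ∀ b, χ a * ψ b = χ b * ψ a := fun b => by
    have hb := h (χ a • b - χ b • a) (by simp [mul_comm])
    simpa [sub_eq_zero] using hb
  have hχψ : χ a = ψ a := by
    have hsq := hprop (a * a)
    rw [map_mul, map_mul, mul_assoc] at hsq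
    exact (mul_right_cancel₀ ha (mul_left_cancel₀ hχa hsq)).symm
  ext b
  exact mul_right_cancel₀ ha (by rw [← hprop b, hχψ, mul_comm])

variable {𝕜 : Type} [RCLike 𝕜] {S T : Type*} [TopologicalSpace S] [TopologicalSpace T]

/-- A continuous function with compact support, as an element of `C_c(T)`. -/
noncomputable def compactSupportedOfContinuous {f : T → 𝕜} (hf : Continuous f)
    (hs : HasCompactSupport f) : compactSupported 𝕜 T :=
  ⟨.ofNormedAddCommGroup f hf _ (hs.exists_bound_of_continuous hf).choose_spec, hs⟩

/-- Evaluation at a point, as a character of `C_c(T)`. -/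
def compactSupportedEval (t : T) : compactSupported 𝕜 T →ₙₐ[𝕜] 𝕜 where
  toFun f := f.1 t
  map_smul' _ _ := rfl
  map_zero' := rfl
  map_add' _ _ := rfl
  map_mul' _ _ := rfl

theorem exists_mul_eq_norm_sq (f : compactSupported 𝕜 T) :
    ∃ g : compactSupported 𝕜 T, ∀ t, (f * g).1 t = ((‖f.1 t‖ ^ 2 : ℝ) : 𝕜) :=
  ⟨compactSupportedOfContinuous (f := fun t => star (f.1 t)) f.1.continuous.star
    (HasCompactSupport.comp_left f.2 (star_zero 𝕜)),
    fun t => (RCLike.mul_conj (f.1 t)).trans (by push_cast; rfl)⟩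

theorem exists_mul_eq_of_forall_ne_zero {e g : compactSupported 𝕜 T}
    (h : ∀ x ∈ tsupport e.1, g.1 x ≠ 0) : ∃ q, g * q = e := by
  have hc : Continuous fun x => e.1 x / g.1 x := by
    refine continuous_iff_continuousAt.2 fun x => ?_
    by_cases hx : x ∈ tsupport e.1
    · exact e.1.continuous.continuousAt.div g.1.continuous.continuousAt (h x hx)
    · have hzero : (fun x => e.1 x / g.1 x) =ᶠ[𝓝 x] fun _ => 0 := by
        filter_upwards [notMem_tsupport_iff_eventuallyEq.1 hx] with y hy
        simp [hy]
      exact hzero.continuousAt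
  have hs : HasCompactSupport fun x => e.1 x / g.1 x :=
    HasCompactSupport.mono (f := ⇑e.1) e.2 fun x hx he => hx (by simp only [he, zero_div])
  refine ⟨compactSupportedOfContinuous hc hs,
    Subtype.ext (BoundedContinuousFunction.ext fun x => ?_)⟩
  change g.1 x * (e.1 x / g.1 x) = e.1 x
  by_cases hx : x ∈ tsupport e.1
  · exact mul_div_cancel₀ _ (h x hx)
  · simp [image_eq_zero_of_notMem_tsupport hx]

/-- Otherwise finitely many functions `gᵢ` in the kernel of `χ` have no common zero on the support
of `e`; then `∑ |gᵢ|²` lies in the kernel and divides `e`. -/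
theorem exists_forall_eq_zero_imp (χ : compactSupported 𝕜 T →ₙₐ[𝕜] 𝕜) {e : compactSupported 𝕜 T}
    (he : χ e ≠ 0) : ∃ t : T, ∀ f, χ f = 0 → f.1 t = 0 := by
  by_contra! h
  choose g hgχ hgt using h
  choose g' hg' using fun t => exists_mul_eq_norm_sq (g t)
  obtain ⟨s, -, hs⟩ := IsCompact.elim_nhds_subcover (s := tsupport e.1) e.2
    (fun t => {x | (g t).1 x ≠ 0})
    fun t _ => (isOpen_ne_fun (g t).1.continuous continuous_const).mem_nhds (hgt t)
  let G := ∑ t ∈ s, g t * g' t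
  have hGχ : χ G = 0 := by
    simp only [G, map_sum, map_mul, hgχ, zero_mul, Finset.sum_const_zero]
  have hG : ∀ x, G.1 x = ((∑ t ∈ s, ‖(g t).1 x‖ ^ 2 : ℝ) : 𝕜) := fun x => by
    rw [RCLike.ofReal_sum]
    exact (map_sum (compactSupportedEval x) _ s).trans (Finset.sum_congr rfl fun t _ => hg' t x)
  obtain ⟨q, rfl⟩ := exists_mul_eq_of_forall_ne_zero (e := e) (g := G) fun x hx => by
    obtain ⟨t, hts, ht⟩ := mem_iUnion₂.1 (hs hx)
    rw [hG, RCLike.ofReal_ne_zero]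
    exact (Finset.sum_pos' (fun _ _ => by positivity)
      ⟨t, hts, pow_pos (norm_pos_iff.2 ht) 2⟩).ne'
  exact he (by rw [map_mul, hGχ, zero_mul])

section

variable [T2Space T] [LocallyCompactSpace T]

variable (𝕜) in
theorem exists_compactSupported_eq_one {t : T} {U : Set T} (hU : IsOpen U) (ht : t ∈ U) :
    ∃ f : compactSupported 𝕜 T, f.1 t = 1 ∧ ∀ x, x ∉ U → f.1 x = 0 := by
  obtain ⟨f, hf1, hf0, hfc, -⟩ := exists_continuous_one_zero_of_isCompact
    (isCompact_singleton (x := t)) hU.isClosed_compl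
    (disjoint_compl_right_iff_subset.2 (singleton_subset_iff.2 ht))
  refine ⟨compactSupportedOfContinuous (RCLike.continuous_ofReal.comp f.continuous)
    (hfc.comp_left RCLike.ofReal_zero), ?_, fun x hx => ?_⟩
  · exact (congrArg _ (hf1 rfl)).trans RCLike.ofReal_one
  · exact (congrArg _ (hf0 hx)).trans RCLike.ofReal_zero

theorem exists_eq_compactSupportedEval {χ : compactSupported 𝕜 T →ₙₐ[𝕜] 𝕜}
    {e : compactSupported 𝕜 T} (he : χ e ≠ 0) : ∃ t : T, χ = compactSupportedEval t := by
  obtain ⟨t, ht⟩ := exists_forall_eq_zero_imp χ he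
  obtain ⟨b, hb, -⟩ := exists_compactSupported_eq_one 𝕜 isOpen_univ (mem_univ t)
  exact ⟨t, eq_of_forall_eq_zero_imp (hb.trans_ne one_ne_zero) ht⟩

theorem eq_of_forall_compactSupported {s t : T}
    (h : ∀ f : compactSupported 𝕜 T, f.1 s = f.1 t) : s = t := by
  by_contra hst
  obtain ⟨f, hf, hf0⟩ := exists_compactSupported_eq_one 𝕜 (isOpen_compl_singleton (x := t)) hst
  exact one_ne_zero (hf.symm.trans ((h f).trans (hf0 t (by simp))))

theorem continuous_of_compactSupported {θ : S → T}
    (h : ∀ f : compactSupported 𝕜 T, Continuous fun s => f.1 (θ s)) : Continuous θ := by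
  refine continuous_iff_continuousAt.2 fun s V hV => ?_
  obtain ⟨U, hUV, hU, hs⟩ := mem_nhds_iff.1 hV
  obtain ⟨f, hf, hf0⟩ := exists_compactSupported_eq_one 𝕜 hU hs
  have hne : {r | f.1 (θ r) ≠ 0} ∈ 𝓝 s :=
    (isOpen_ne_fun (h f) continuous_const).mem_nhds (by simp [hf])
  exact Filter.mem_map.2 (Filter.mem_of_superset hne fun r hr =>
    hUV (not_not.1 (mt (hf0 (θ r)) hr)))

end

variable [T2Space S] [LocallyCompactSpace S] [T2Space T] [LocallyCompactSpace T]

theorem exists_forall_apply_eq_of_surjective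
    {ψ : compactSupported 𝕜 S →ₙₐ[𝕜] compactSupported 𝕜 T} (hψ : Function.Surjective ψ) :
    ∃ θ : T → S, ∀ f t, (ψ f).1 t = f.1 (θ t) := by
  have heval : ∀ t : T, ∃ s : S, (compactSupportedEval t).comp ψ = compactSupportedEval s := by
    intro t
    obtain ⟨b, hb, -⟩ := exists_compactSupported_eq_one 𝕜 isOpen_univ (mem_univ t)
    obtain ⟨e, rfl⟩ := hψ b
    exact exists_eq_compactSupportedEval (e := e) (hb.trans_ne one_ne_zero)
  choose θ hθ using heval
  exact ⟨θ, fun f t => DFunLike.congr_fun (hθ t) f⟩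

theorem nonempty_homeomorph_of_bijective
    {ψ : compactSupported 𝕜 S →ₙₐ[𝕜] compactSupported 𝕜 T} (hψ : Function.Bijective ψ) :
    Nonempty (T ≃ₜ S) := by
  obtain ⟨g, hleft, hright⟩ := Function.bijective_iff_has_inverse.1 hψ
  obtain ⟨θ, hθ⟩ := exists_forall_apply_eq_of_surjective hψ.2
  obtain ⟨η, hη⟩ := exists_forall_apply_eq_of_surjective (ψ := ψ.inverse g hleft hright)
    hleft.surjective
  replace hη : ∀ f s, (g f).1 s = f.1 (η s) := hη
  refine ⟨⟨⟨θ, η, fun t => ?_, fun s => ?_⟩, ?_, ?_⟩⟩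
  · refine eq_of_forall_compactSupported (𝕜 := 𝕜) fun f => ?_
    rw [← hη, ← hθ, hright]
  · refine eq_of_forall_compactSupported (𝕜 := 𝕜) fun f => ?_
    rw [← hθ, ← hη, hleft]
  · refine continuous_of_compactSupported (𝕜 := 𝕜) fun f => ?_
    simpa only [← hθ] using (ψ f).1.continuous
  · refine continuous_of_compactSupported (𝕜 := 𝕜) fun f => ?_
    simpa only [← hη] using (g f).1.continuous

end BanachStone

section NotNormal

theorem exists_clopens_mem_iff {Z : Type*} [TopologicalSpace Z] [CompactSpace Z] [T2Space Z]
    [TotallyDisconnectedSpace Z] (F : Finset Z) (T : Set Z) :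
    ∃ c : TopologicalSpace.Clopens Z, ∀ z ∈ F, z ∈ c ↔ z ∈ T := by
  have hsub : (F ∩ T : Set Z) ⊆ (F \ T)ᶜ := fun z hz hz' => hz'.2 hz.2
  obtain ⟨c, hc, hTc, hcT⟩ := exists_clopen_of_closed_subset_open
    (F.finite_toSet.inter_of_left T).isClosed
    (F.finite_toSet.sdiff (t := T)).isClosed.isOpen_compl hsub
  exact ⟨⟨c, hc⟩, fun z hz => ⟨fun hzc => by_contra fun hzT => hcT hzc ⟨hz, hzT⟩,
    fun hzT => hTc ⟨hz, hzT⟩⟩⟩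

/-- The sets `{c | z ∈ c}` of clopen sets, for varying `z`, form an independent family. -/
theorem exists_ultrafilter_clopens {Z : Type*} [TopologicalSpace Z] [CompactSpace Z] [T2Space Z]
    [TotallyDisconnectedSpace Z] (T : Set Z) :
    ∃ W : Ultrafilter (TopologicalSpace.Clopens Z), ∀ z, {c | z ∈ c} ∈ W ↔ z ∈ T := by
  classical
  choose c hc using fun F : Finset Z => exists_clopens_mem_iff F T
  let V : Ultrafilter (Finset Z) := Ultrafilter.of Filter.atTop
  refine ⟨V.map c, fun z => ?_⟩
  have hev : ∀ᶠ F in V, z ∈ c F ↔ z ∈ T :=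
    Ultrafilter.of_le Filter.atTop ((Filter.eventually_ge_atTop {z}).mono fun F hF =>
      hc F z (Finset.singleton_subset_iff.1 hF))
  exact (Filter.eventually_congr hev).trans Filter.eventually_const

section Order

variable {Ω Y : Type*} [LinearOrder Ω] [TopologicalSpace Y]

theorem exists_forall_lt_of_countable (hΩ : ℵ₀ < Order.cof Ω) {s : Set Ω} (hs : s.Countable) :
    ∃ b, ∀ a ∈ s, a < b :=
  not_isCofinal_iff.1 fun h =>
    (hΩ.trans_le (Order.cof_le h)).not_ge (Cardinal.le_aleph0_iff_set_countable.2 hs)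

theorem exists_gt_mem_of_iInter_subset [NoMaxOrder Ω] {V : Ω → Set Y} (hV : ∀ η, IsClosed (V η))
    {K : Set Y} (hK : IsCompact K) {y : Ω → Y} (hyK : ∀ β, y β ∈ K)
    (hyV : ∀ β η, η < β → y β ∈ V η) {H : Set Y} (hH : IsOpen H) (hVH : ⋂ η, V η ⊆ H) (ξ : Ω) :
    ∃ β > ξ, y β ∈ H := by
  have : Nonempty Ω := ⟨ξ⟩
  obtain ⟨a, -, ha⟩ := hK.exists_mapClusterPt (f := Filter.atTop) (u := y)
    (Filter.tendsto_principal.2 (.of_forall hyK))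
  have haV : a ∈ ⋂ η, V η := mem_iInter.2 fun η =>
    (hV η).mem_of_mapClusterPt ha ((Filter.eventually_gt_atTop η).mono fun β => hyV β η)
  obtain ⟨β, hβH, hβ⟩ := ((ha.frequently (hH.mem_nhds (hVH haV))).and_eventually
    (Filter.eventually_gt_atTop ξ)).exists
  exact ⟨β, hβ, hβH⟩

theorem isClosed_setOf_mem_iff_mem {U V : Set Y} (hU : IsClopen U) (hV : IsClopen V) :
    IsClosed {y | y ∈ U ↔ y ∈ V} := by
  have heq : {y | y ∈ U ↔ y ∈ V} = U ∩ V ∪ Uᶜ ∩ Vᶜ := by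
    ext y
    exact iff_iff_and_or_not_and_not
  rw [heq]
  exact ((hU.inter hV).union (hU.compl.inter hV.compl)).1

theorem mapClusterPt_mem_iff_mem {U V : Ω → Set Y} (hU : ∀ η, IsClopen (U η))
    (hV : ∀ η, IsClopen (V η)) {ξ : ℕ → Ω} (hξ : StrictMono ξ) {z : ℕ → Y}
    (hzU : ∀ n η, z n ∈ U η ↔ η < ξ n) (hzV : ∀ n η, z n ∈ V η ↔ η < ξ (n + 1)) {a : Y}
    (ha : MapClusterPt a Filter.atTop z) (η : Ω) : a ∈ U η ↔ a ∈ V η := by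
  refine (isClosed_setOf_mem_iff_mem (hU η) (hV η)).mem_of_mapClusterPt ha ?_
  simp only [mem_ofPred_eq, hzU, hzV]
  by_cases hη : ∃ m, η < ξ m
  · obtain ⟨m, hm⟩ := hη
    filter_upwards [Filter.eventually_ge_atTop m] with n hn
    have hηn : η < ξ n := hm.trans_le (hξ.monotone hn)
    exact iff_of_true hηn (hηn.trans (hξ n.lt_succ_self))
  · exact .of_forall fun n => iff_of_false (fun h => hη ⟨n, h⟩) fun h => hη ⟨n + 1, h⟩

/-- An abstract form of the proof that `ω₁ × (ω₁ + 1)` is not normal: there `y ξ β = (ξ, β)`, and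
`U η`, `V η` are the sets of the points whose first, respectively second, coordinate exceeds `η`.
The diagonal `{y | ∀ η, y ∈ U η ↔ y ∈ V η}` and the edge `⋂ η, V η` cannot be separated. -/
theorem not_normalSpace_of_isClopen_families [CountablyCompactSpace Y] [NoMaxOrder Ω] [Nonempty Ω]
    {U V : Ω → Set Y} (hU : ∀ η, IsClopen (U η)) (hV : ∀ η, IsClopen (V η))
    (hUempty : ⋂ η, U η = ∅) {K : Ω → Set Y} (hK : ∀ ξ, IsCompact (K ξ)) {y : Ω → Ω → Y}
    (hyK : ∀ ξ β, y ξ β ∈ K ξ) (hyU : ∀ ξ β η, y ξ β ∈ U η ↔ η < ξ)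
    (hyV : ∀ ξ β η, y ξ β ∈ V η ↔ η < β) : ¬ NormalSpace Y := by
  intro _
  have hdisj : Disjoint (⋂ η, {y | y ∈ U η ↔ y ∈ V η}) (⋂ η, V η) :=
    disjoint_left.2 fun y hdiag hedge => hUempty.subset
      (mem_iInter.2 fun η => (mem_iInter.1 hdiag η).2 (mem_iInter.1 hedge η))
  obtain ⟨G, H, hG, hH, hdiagG, hedgeH, hGH⟩ := normal_separation
    (isClosed_iInter fun η => isClosed_setOf_mem_iff_mem (hU η) (hV η))
    (isClosed_iInter fun η => (hV η).1) hdisj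
  choose β hβ hβH using fun ξ => exists_gt_mem_of_iInter_subset (fun η => (hV η).1) (hK ξ) (hyK ξ)
    (fun β η => (hyV ξ β η).2) hH hedgeH ξ
  obtain ⟨ξ₀⟩ := ‹Nonempty Ω›
  let ξ : ℕ → Ω := fun n => β^[n] ξ₀
  have hξ : ∀ n, ξ (n + 1) = β (ξ n) := fun n => Function.iterate_succ_apply' β n ξ₀
  have hξmono : StrictMono ξ := strictMono_nat_of_lt_succ fun n => (hβ (ξ n)).trans_eq (hξ n).symm
  obtain ⟨a, -, ha⟩ := isCountablyCompact_iff_seq_clusterPt.1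
    CountablyCompactSpace.isCountablyCompact_univ (fun n => y (ξ n) (β (ξ n)))
    (.of_forall fun n => mem_univ _)
  have hadiag : a ∈ ⋂ η, {y | y ∈ U η ↔ y ∈ V η} := mem_iInter.2 fun η =>
    mapClusterPt_mem_iff_mem hU hV hξmono (fun n => hyU _ _) (fun n => hξ n ▸ hyV _ _) ha η
  obtain ⟨n, hn⟩ := (ha.frequently (hG.mem_nhds (hdiagG hadiag))).exists
  exact disjoint_left.1 hGH hn (hβH (ξ n))

end Order

namespace IsLindelofPartition

variable {X : Type u} [TopologicalSpace X] {I : Type*} {p : X → I} (𝕜 : Type) [RCLike 𝕜]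

theorem exists_extend_eq (hp : IsLindelofPartition p) {J : Set I} (hJ : J.Countable)
    {w : Ultrafilter I} (hw : J ∈ w) : ∃ y : lambdaLindelof 𝕜 X, hp.extend y = w := by
  obtain ⟨y, rfl⟩ := hp.extend_surjective w
  exact ⟨⟨y, (hp.lambdaLindelof_eq 𝕜).superset ⟨J, hJ, hw⟩⟩, rfl⟩

theorem iInter_block_eq_empty (hp : IsLindelofPartition p) {Ω : Type*} [LinearOrder Ω]
    (hΩ : ℵ₀ < Order.cof Ω) (r : I → Ω) : ⋂ η, hp.block 𝕜 {i | η < r i} = ∅ := by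
  refine eq_empty_of_forall_notMem fun y hy => ?_
  obtain ⟨J, hJ, hyJ⟩ := hp.exists_countable_mem_block 𝕜 y
  obtain ⟨η, hη⟩ := exists_forall_lt_of_countable hΩ (hJ.image r)
  obtain ⟨i, hi, hiJ⟩ :=
    (hp.extend y).nonempty_of_mem (Filter.inter_mem (mem_iInter.1 hy η) hyJ)
  exact lt_asymm hi (hη _ ⟨i, hiJ, rfl⟩)

theorem not_normalSpace_of_embedding (hp : IsLindelofPartition p) {Ω Z : Type*} [LinearOrder Ω]
    [Nonempty Ω] (hΩ : ℵ₀ < Order.cof Ω) [TopologicalSpace Z] [CompactSpace Z] [T2Space Z]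
    [TotallyDisconnectedSpace Z] [Countable (TopologicalSpace.Clopens Z)] (h : Ω ↪ Z)
    (e : Ω × TopologicalSpace.Clopens Z ↪ I) : ¬ NormalSpace (lambdaLindelof 𝕜 X) := by
  have := hp.countablyCompactSpace_lambdaLindelof 𝕜
  have : NoMaxOrder Ω := ⟨fun a =>
    (exists_forall_lt_of_countable hΩ (countable_singleton a)).imp fun b hb => hb a rfl⟩
  have : Nonempty (Ω × TopologicalSpace.Clopens Z) := ⟨Classical.arbitrary Ω, ⊥⟩
  obtain ⟨q, hq⟩ := e.injective.hasLeftInverse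
  choose W hW using fun T : Set Z => exists_ultrafilter_clopens T
  let w : Ω → Ω → Ultrafilter I := fun ξ β => (W (h '' Iio β)).map fun c => e (ξ, c)
  have hcount : ∀ ξ, (range fun c => e (ξ, c)).Countable := fun ξ => countable_range _
  have hw : ∀ ξ β, range (fun c => e (ξ, c)) ∈ w ξ β := fun ξ β =>
    Filter.mem_map.2 (Filter.univ_mem' mem_range_self)
  choose y hy using fun ξ β => hp.exists_extend_eq 𝕜 (hcount ξ) (hw ξ β)
  refine not_normalSpace_of_isClopen_families (Ω := Ω) (y := y)
    (U := fun η => hp.block 𝕜 {i | η < (q i).1}) (V := fun η => hp.block 𝕜 {i | h η ∈ (q i).2})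
    (K := fun ξ => hp.block 𝕜 (range fun c => e (ξ, c)))
    (fun _ => hp.isClopen_block 𝕜 _) (fun _ => hp.isClopen_block 𝕜 _)
    (hp.iInter_block_eq_empty 𝕜 hΩ fun i => (q i).1) (fun ξ => hp.isCompact_block 𝕜 (hcount ξ))
    (fun ξ β => ?_) (fun ξ β η => ?_) fun ξ β η => ?_
  · exact (congrArg (_ ∈ ·) (hy ξ β)).mpr (hw ξ β)
  · change {i | η < (q i).1} ∈ hp.extend (y ξ β) ↔ η < ξ
    rw [hy, Ultrafilter.mem_map]
    simp only [preimage_ofPred_eq, hq (ξ, _)]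
    exact Filter.eventually_const
  · change {i | h η ∈ (q i).2} ∈ hp.extend (y ξ β) ↔ η < β
    rw [hy, Ultrafilter.mem_map]
    simp only [preimage_ofPred_eq, hq (ξ, _), hW, h.injective.mem_set_image, mem_Iio]

theorem not_normalSpace (hp : IsLindelofPartition p) (hX : ¬ LindelofSpace X) :
    ¬ NormalSpace (lambdaLindelof 𝕜 X) := by
  have := hp.uncountable hX
  let Ω : Type := (ℵ₁ : Cardinal.{0}).ord.ToType
  have hΩ : #Ω = ℵ₁ := Cardinal.mk_ord_toType ℵ₁
  have hcof : ℵ₀ < Order.cof Ω := by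
    rw [Ordinal.cof_toType, Cardinal.isRegular_aleph_one.cof_ord]
    exact Cardinal.aleph0_lt_aleph_one
  have : Nonempty Ω := Cardinal.mk_ne_zero_iff.1 (hΩ ▸ (Cardinal.aleph_pos 1).ne')
  have : Countable (TopologicalSpace.Clopens (ℕ → Bool)) :=
    TopologicalSpace.Clopens.countable_iff_secondCountable.2 inferInstance
  obtain ⟨h⟩ : Nonempty (Ω ↪ (ℕ → Bool)) := by
    rw [← Cardinal.le_def, hΩ]
    simpa using Cardinal.aleph_one_le_continuum
  obtain ⟨e⟩ : Nonempty (Ω × TopologicalSpace.Clopens (ℕ → Bool) ↪ I) := by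
    have hprod : #(Ω × TopologicalSpace.Clopens (ℕ → Bool)) ≤ ℵ₁ := by
      rw [Cardinal.mk_prod, Cardinal.lift_id, Cardinal.lift_id, hΩ]
      exact Cardinal.mul_le_of_le (Cardinal.aleph0_le_aleph 1) le_rfl
        (Cardinal.mk_le_aleph0.trans (Cardinal.aleph0_le_aleph 1))
    have hI : ℵ₁ ≤ #I := Cardinal.aleph_one_le_iff.2 Cardinal.aleph0_lt_mk
    rw [← Cardinal.lift_mk_le']
    exact (Cardinal.lift_le.2 hprod).trans (by simp [hI])
  exact hp.not_normalSpace_of_embedding 𝕜 hcof h e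

end IsLindelofPartition

end NotNormal

section Rank

theorem mk_le_continuum (𝕜 : Type) [RCLike 𝕜] : #𝕜 ≤ 𝔠 := by
  have hinj : Function.Injective fun z : 𝕜 => (RCLike.re z, RCLike.im z) := fun z w h =>
    RCLike.ext (congrArg Prod.fst h) (congrArg Prod.snd h)
  simpa [Cardinal.mk_real] using Cardinal.mk_le_of_injective hinj

theorem rank_eq_mk_of_lift_mk_le_lift_rank {K : Type u} {V : Type v} [Field K] [Infinite K]
    [AddCommGroup V] [Module K V]
    (h : Cardinal.lift.{v} #K ≤ Cardinal.lift.{u} (Module.rank K V)) : Module.rank K V = #V := by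
  by_cases hlt : Cardinal.lift.{v} #K < Cardinal.lift.{u} #V
  · exact Module.Free.rank_eq_mk_of_infinite_lt K V hlt
  · exact rank_le_card K V |>.antisymm (Cardinal.lift_le.1 ((not_lt.1 hlt).trans h))

theorem linearIndependent_geometric {K : Type*} [Field K] {ι : Type*} {a : ι → K}
    (ha : Function.Injective a) : LinearIndependent K fun (i : ι) (n : ℕ) => a i ^ n := by
  have hpow : Function.Injective fun i => powersHom K (a i) := (powersHom K).injective.comp ha
  exact (linearIndependent_monoidHom (Multiplicative ℕ) K).comp _ hpow

theorem continuum_le_rank {𝕜 : Type} [RCLike 𝕜] {E : Type*} [NormedAddCommGroup E]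
    [NormedSpace 𝕜 E] [CompleteSpace E] {e : ℕ → E} {C : ℝ} (he : ∀ n, ‖e n‖ ≤ C)
    {φ : ℕ → E →L[𝕜] 𝕜} (hφ : ∀ m n, φ m (e n) = if n = m then 1 else 0) :
    𝔠 ≤ Module.rank 𝕜 E := by
  have hsummable : ∀ t : Ioo (0 : ℝ) 1, Summable fun n => ((t : ℝ) : 𝕜) ^ n • e n := fun t => by
    refine .of_norm_bounded
      ((summable_geometric_of_lt_one t.2.1.le t.2.2).mul_right C) fun n => ?_
    rw [norm_smul, norm_pow, RCLike.norm_of_nonneg t.2.1.le]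
    exact mul_le_mul_of_nonneg_left (he n) (pow_nonneg t.2.1.le n)
  let F : Ioo (0 : ℝ) 1 → E := fun t => ∑' n, ((t : ℝ) : 𝕜) ^ n • e n
  have hφF : ∀ t m, φ m (F t) = ((t : ℝ) : 𝕜) ^ m := fun t m => by
    rw [(φ m).map_tsum (hsummable t), tsum_eq_single m fun n hn => by simp [hφ, hn]]
    simp [hφ]
  have hF : LinearIndependent 𝕜 F := by
    refine .of_comp (LinearMap.pi fun m => (φ m : E →ₗ[𝕜] 𝕜)) ?_
    have hcomp : (LinearMap.pi fun m => (φ m : E →ₗ[𝕜] 𝕜)) ∘ F =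
        fun (t : Ioo (0 : ℝ) 1) (m : ℕ) => ((t : ℝ) : 𝕜) ^ m := by
      ext t m
      exact hφF t m
    rw [hcomp]
    exact linearIndependent_geometric (RCLike.ofReal_injective.comp Subtype.val_injective)
  simpa [Cardinal.mk_Ioo_real one_pos] using hF.cardinal_lift_le_rank

theorem exists_biorthogonal_seq (𝕜 X : Type*) [RCLike 𝕜] [TopologicalSpace X] [T35Space X]
    [Infinite X] : ∃ (x : ℕ → X) (f : ℕ → X →ᵇ 𝕜), (∀ n, ‖f n‖ ≤ 1) ∧
      ∀ m n, f n (x m) = if n = m then 1 else 0 := by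
  obtain ⟨U, hU, hUopen, hdisj⟩ := exists_seq_infinite_isOpen_pairwise_disjoint X
  choose x hx using fun n => (hU n).nonempty
  choose g hg hgx hgU using fun n => CompletelyRegularSpace.completely_regular (x n) (U n)ᶜ
    (hUopen n).isClosed_compl (notMem_compl_iff.2 (hx n))
  have hcont : ∀ n, Continuous fun y => ((1 - g n y : ℝ) : 𝕜) := fun n =>
    RCLike.continuous_ofReal.comp (continuous_const.sub (continuous_subtype_val.comp (hg n)))
  have hnorm : ∀ n y, ‖((1 - g n y : ℝ) : 𝕜)‖ ≤ 1 := fun n y => by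
    rw [RCLike.norm_of_nonneg (sub_nonneg.2 (g n y).2.2)]
    exact sub_le_self 1 (g n y).2.1
  refine ⟨x, fun n => .ofNormedAddCommGroup _ (hcont n) 1 (hnorm n),
    fun n => norm_ofNormedAddCommGroup_le _ zero_le_one (hnorm n), fun m n => ?_⟩
  change ((1 - g n (x m) : ℝ) : 𝕜) = _
  split_ifs with hnm
  · simp [hnm, hgx]
  · have hxU : x m ∈ (U n)ᶜ := disjoint_right.1 (hdisj hnm) (hx m)
    simp [hgU n hxU]

end Rank

section Separable

open TopologicalSpace

variable {X : Type*} [TopologicalSpace X]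

theorem isSeparable_of_isLindelof [PseudoMetrizableSpace X] {s : Set X} (hs : IsLindelof s) :
    IsSeparable s := by
  let _ := pseudoMetrizableSpacePseudoMetric X
  obtain ⟨t, -, ht⟩ := UniformSpace.subset_countable_closure_of_almost_dense_set s fun U hU =>
    (hs.elim_nhds_subcover _ fun x _ => UniformSpace.ball_mem_nhds x hU).imp fun t ht =>
      ⟨ht.1, ht.2.2⟩
  exact ⟨t, ht⟩

theorem IsLocallyLindelof.exists_mem_nhds_isSeparable [PseudoMetrizableSpace X]
    (hX : IsLocallyLindelof X) (x : X) : ∃ U ∈ 𝓝 x, IsSeparable U :=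
  (hX x).imp fun _ => And.imp_right isSeparable_of_isLindelof

theorem isSeparable_of_isLindelof_of_locally (hX : ∀ x : X, ∃ U ∈ 𝓝 x, IsSeparable U) {s : Set X}
    (hs : IsLindelof s) : IsSeparable s := by
  choose U hU hUsep using hX
  obtain ⟨t, ht, -, hst⟩ := hs.elim_nhds_subcover U fun x _ => hU x
  have := ht.to_subtype
  rw [biUnion_eq_iUnion] at hst
  exact (IsSeparable.iUnion fun x : t => hUsep x).mono hst

end Separable

namespace IsLindelofPartition

variable {X : Type u} [TopologicalSpace X] {I : Type u} {p : X → I}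

section LindelofNumber

theorem mk_le_mk_of_subset_range_preimage (hp : IsLindelofPartition p) {𝒱 : Set (Set X)}
    (h𝒱 : 𝒱 ⊆ range fun i => p ⁻¹' {i}) (hcov : ⋃₀ 𝒱 = univ) : #I ≤ #𝒱 := by
  have hmem : ∀ i, p ⁻¹' {i} ∈ 𝒱 := fun i => by
    obtain ⟨x, rfl⟩ := hp.surjective i
    obtain ⟨U, hU, hxU⟩ := mem_sUnion.1 (hcov.superset (mem_univ x))
    obtain ⟨j, rfl⟩ := h𝒱 hU
    rwa [show p x = j from hxU]
  refine Cardinal.mk_le_of_injective (f := fun i => (⟨_, hmem i⟩ : 𝒱)) fun i j hij => ?_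
  exact singleton_injective (hp.surjective.preimage_injective (congrArg Subtype.val hij))

theorem exists_subcover_mk_le (hp : IsLindelofPartition p) {𝒰 : Set (Set X)}
    (h𝒰 : ∀ U ∈ 𝒰, IsOpen U) (hcov : ⋃₀ 𝒰 = univ) :
    ∃ 𝒱 ⊆ 𝒰, ⋃₀ 𝒱 = univ ∧ #𝒱 ≤ max #I ℵ₀ := by
  rw [sUnion_eq_iUnion] at hcov
  choose r hr hir using fun i => (hp.isLindelof_fiber i).elim_countable_subcover
    (fun U : 𝒰 => (U : Set X)) (fun U => h𝒰 U U.2) (hcov.superset.trans' (subset_univ _))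
  refine ⟨⋃ i, Subtype.val '' r i, ?_, ?_, ?_⟩
  · exact iUnion_subset fun i => Subtype.coe_image_subset 𝒰 (r i)
  · refine eq_univ_of_forall fun x => ?_
    obtain ⟨U, hU, hx⟩ := mem_iUnion₂.1 (hir (p x) rfl)
    exact mem_sUnion.2 ⟨U, mem_iUnion.2 ⟨p x, U, hU, rfl⟩, hx⟩
  · calc #(⋃ i, Subtype.val '' r i) ≤ #I * ⨆ i, #(Subtype.val '' r i) := Cardinal.mk_iUnion_le _
      _ ≤ #I * ℵ₀ := mul_le_mul_right (ciSup_le' fun i =>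
        Cardinal.le_aleph0_iff_set_countable.2 ((hr i).image _)) _
      _ ≤ max #I ℵ₀ := Cardinal.mul_le_max_of_aleph0_le_right le_rfl

theorem lindelofNumber_eq (hp : IsLindelofPartition p) : lindelofNumber X = max #I ℵ₀ := by
  have hmem : max #I ℵ₀ ∈ {n : Cardinal.{u} | ∀ 𝒰 : Set (Set X), (∀ U ∈ 𝒰, IsOpen U) →
      ⋃₀ 𝒰 = univ → ∃ 𝒱 ⊆ 𝒰, ⋃₀ 𝒱 = univ ∧ #𝒱 ≤ n} :=
    fun _ h𝒰 hcov => hp.exists_subcover_mk_le h𝒰 hcov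
  have hge := le_csInf ⟨_, hmem⟩ fun n hn => by
    obtain ⟨𝒱, h𝒱, hcov, hcard⟩ := hn (range fun i => p ⁻¹' {i})
      (forall_mem_range.2 fun i => (hp.isClopen_preimage {i}).2)
      (by rw [sUnion_range, ← preimage_iUnion, iUnion_of_singleton, preimage_univ])
    exact (hp.mk_le_mk_of_subset_range_preimage h𝒱 hcov).trans hcard
  rw [lindelofNumber, Cardinal.add_eq_max' le_rfl]
  exact le_antisymm (max_le (csInf_le' hmem) (le_max_right _ _)) (max_le_max_right _ hge)

end LindelofNumber

section Dimension

variable (𝕜 : Type) [RCLike 𝕜]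

theorem norm_indicator_le_one (hp : IsLindelofPartition p) (J : Set I) :
    ‖hp.indicator 𝕜 J‖ ≤ 1 :=
  norm_ofNormedAddCommGroup_le _ zero_le_one _

theorem continuum_le_rank_lindelofSupported [T35Space X] [Infinite X]
    (hp : IsLindelofPartition p) : 𝔠 ≤ Module.rank 𝕜 (lindelofSupported 𝕜 X) := by
  obtain ⟨x, f, hf, hfx⟩ := exists_biorthogonal_seq 𝕜 X
  let S := (lindelofSupported 𝕜 X).toSubmodule
  have : CompleteSpace S := hp.completeSpace_lindelofSupported 𝕜
  let e : ℕ → S := fun n => ⟨hp.indicator 𝕜 {p (x n)} * f n,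
    hp.mem_lindelofSupported_iff.2 ⟨{p (x n)}, countable_singleton _, by
      exact (Function.support_mul_subset_left _ _).trans (hp.support_indicator 𝕜 _).subset⟩⟩
  refine continuum_le_rank (e := e) (C := 1) (fun n => ?_)
    (φ := fun m => (evalCLM 𝕜 (x m)).comp S.subtypeL) fun m n => ?_
  · exact (norm_mul_le _ _).trans
      (mul_le_one₀ (hp.norm_indicator_le_one 𝕜 _) (norm_nonneg _) (hf n))
  · change ({p (x n)} : Set I).indicator 1 (p (x m)) * f n (x m) = _
    rw [hfx]
    split_ifs with hnm
    · simp [hnm]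
    · exact mul_zero _

theorem indicator_injective (hp : IsLindelofPartition p) :
    Function.Injective (hp.indicator 𝕜) := fun J K hJK => by
  apply hp.surjective.preimage_injective
  rw [← hp.support_indicator 𝕜, hJK, hp.support_indicator]

theorem mk_pow_aleph0_le_mk_lindelofSupported [Infinite I] (hp : IsLindelofPartition p) :
    #I ^ (ℵ₀ : Cardinal.{u}) ≤ #(lindelofSupported 𝕜 X) := by
  obtain ⟨e⟩ : Nonempty (ℕ × I ≃ I) := Cardinal.lift_mk_eq'.1 (by simp)
  let F : (ℕ → I) → lindelofSupported 𝕜 X := fun s =>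
    ⟨_, hp.indicator_mem_lindelofSupported (countable_range fun n => e (n, s n))⟩
  have hF : Function.Injective F := fun s t hst => by
    have hrange := hp.indicator_injective 𝕜 (congrArg Subtype.val hst)
    ext n
    obtain ⟨m, hm⟩ := hrange.subset (mem_range_self n)
    obtain ⟨rfl, hmn⟩ := Prod.ext_iff.1 (e.injective hm)
    exact hmn.symm
  simpa using Cardinal.mk_le_of_injective hF

theorem exists_dense_seq_preimage [Nonempty X] (hp : IsLindelofPartition p)
    (hX : ∀ x : X, ∃ U ∈ 𝓝 x, TopologicalSpace.IsSeparable U) {J : Set I} (hJ : J.Countable) :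
    ∃ d : ℕ → X, p ⁻¹' J ⊆ closure (range d) := by
  obtain ⟨c, hc, hJc⟩ := isSeparable_of_isLindelof_of_locally hX (hp.isLindelof_preimage hJ)
  obtain ⟨d, hd⟩ := countable_iff_exists_subset_range.1 hc
  exact ⟨d, hJc.trans (closure_mono hd)⟩

theorem mk_lindelofSupported_le [Nonempty X] (hp : IsLindelofPartition p)
    (hX : ∀ x : X, ∃ U ∈ 𝓝 x, TopologicalSpace.IsSeparable U) :
    #(lindelofSupported 𝕜 X) ≤ max #I ℵ₀ ^ (ℵ₀ : Cardinal.{u}) := by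
  have : Nonempty I := ‹Nonempty X›.map p
  choose d hd using fun s : ℕ → I => hp.exists_dense_seq_preimage hX (countable_range s)
  have hs : ∀ f : lindelofSupported 𝕜 X, ∃ s : ℕ → I, Function.support f.1 ⊆ p ⁻¹' range s :=
    fun f => by
      obtain ⟨J, hJ, hfJ⟩ := hp.mem_lindelofSupported_iff.1 f.2
      obtain ⟨s, hJs⟩ := countable_iff_exists_subset_range.1 hJ
      exact ⟨s, hfJ.trans (preimage_mono hJs)⟩
  choose s hs using hs
  let Φ : lindelofSupported 𝕜 X → (ℕ → I) × (ℕ → 𝕜) := fun f => (s f, f.1 ∘ d (s f))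
  have hΦ : Function.Injective Φ := fun f g hfg => by
    obtain ⟨hsfg : s f = s g, hdfg : f.1 ∘ d (s f) = g.1 ∘ d (s g)⟩ := Prod.ext_iff.1 hfg
    rw [← hsfg] at hdfg
    have heq : EqOn f.1 g.1 (closure (range (d (s f)))) :=
      EqOn.closure (forall_mem_range.2 (congrFun hdfg)) f.1.continuous g.1.continuous
    refine Subtype.ext (BoundedContinuousFunction.ext fun x => ?_)
    by_cases hx : p x ∈ range (s f)
    · exact heq (hd _ hx)
    · rw [Function.notMem_support.1 (mt (@hs f x) hx),
        Function.notMem_support.1 (mt (@hs g x) (hsfg ▸ hx))]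
  have hℓ : ℵ₀ ≤ max #I ℵ₀ := le_max_right _ _
  have hfun : #(ℕ → I) ≤ max #I ℵ₀ ^ (ℵ₀ : Cardinal.{u}) := by
    simpa using Cardinal.power_le_power_right (c := ℵ₀) (le_max_left #I ℵ₀)
  have hscalar : Cardinal.lift.{u} #(ℕ → 𝕜) ≤ max #I ℵ₀ ^ (ℵ₀ : Cardinal.{u}) := by
    calc Cardinal.lift.{u} #(ℕ → 𝕜) = Cardinal.lift.{u} (#𝕜 ^ ℵ₀) := by simp
      _ ≤ Cardinal.lift.{u} (𝔠 ^ ℵ₀) :=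
        Cardinal.lift_le.2 (Cardinal.power_le_power_right (mk_le_continuum 𝕜))
      _ = ℵ₀ ^ ℵ₀ := by simp
      _ ≤ max #I ℵ₀ ^ ℵ₀ := Cardinal.power_le_power_right hℓ
  refine (Cardinal.mk_le_of_injective hΦ).trans ?_
  rw [Cardinal.mk_prod, Cardinal.lift_uzero]
  exact Cardinal.mul_le_of_le (hℓ.trans (Cardinal.self_le_power _ Cardinal.one_le_aleph0)) hfun
    hscalar

theorem rank_lindelofSupported [T35Space X] [Infinite X] (hp : IsLindelofPartition p)
    (hX : ∀ x : X, ∃ U ∈ 𝓝 x, TopologicalSpace.IsSeparable U) :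
    Module.rank 𝕜 (lindelofSupported 𝕜 X) = lindelofNumber X ^ (ℵ₀ : Cardinal.{u}) := by
  have hrank := hp.continuum_le_rank_lindelofSupported 𝕜
  have hmk : Module.rank 𝕜 (lindelofSupported 𝕜 X) = #(lindelofSupported 𝕜 X) :=
    rank_eq_mk_of_lift_mk_le_lift_rank
      ((Cardinal.lift_le.2 (mk_le_continuum 𝕜)).trans (by simpa using hrank))
  rw [hmk] at hrank ⊢
  rw [hp.lindelofNumber_eq]
  refine (hp.mk_lindelofSupported_le 𝕜 hX).antisymm ?_
  rcases finite_or_infinite I with hI | hI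
  · rwa [max_eq_right Cardinal.mk_le_aleph0, Cardinal.aleph0_power_aleph0]
  · rw [max_eq_left (Cardinal.aleph0_le_mk I)]
    exact hp.mk_pow_aleph0_le_mk_lindelofSupported 𝕜

end Dimension

end IsLindelofPartition

theorem theorem4p6_general (𝕜 : Type) [RCLike 𝕜] (X : Type u) [TopologicalSpace X] [T2Space X]
    [ParacompactSpace X] (hX : IsLocallyLindelof X) :
    CompleteSpace (lindelofSupported 𝕜 X) ∧
    T2Space (lambdaLindelof 𝕜 X) ∧ LocallyCompactSpace (lambdaLindelof 𝕜 X) ∧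
    IsometricallyIsomorphic 𝕜 (lindelofSupported 𝕜 X)
      (compactSupported 𝕜 (lambdaLindelof 𝕜 X)) ∧
    (∀ (T : Type v) [TopologicalSpace T] [T2Space T] [LocallyCompactSpace T]
      (φ : lindelofSupported 𝕜 X →ₙₐ[𝕜] compactSupported 𝕜 T), Function.Bijective φ →
        Nonempty (T ≃ₜ lambdaLindelof 𝕜 X)) ∧
    (lindelofSupported 𝕜 X : Set (X →ᵇ 𝕜)) = {f : X →ᵇ 𝕜 | IsLindelof (tsupport f)} ∧
    vanishingAtInfinity 𝕜 X ⊆ (lindelofSupported 𝕜 X : Set (X →ᵇ 𝕜)) ∧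
    (¬ LindelofSpace X →
      vanishingAtInfinity 𝕜 X ⊂ (lindelofSupported 𝕜 X : Set (X →ᵇ 𝕜))) ∧
    (compactSupported 𝕜 (lambdaLindelof 𝕜 X) : Set (lambdaLindelof 𝕜 X →ᵇ 𝕜)) =
      vanishingAtInfinity 𝕜 (lambdaLindelof 𝕜 X) ∧
    CountablyCompactSpace (lambdaLindelof 𝕜 X) ∧
    (¬ LindelofSpace X → ¬ NormalSpace (lambdaLindelof 𝕜 X)) ∧
    ((∀ x : X, ∃ U ∈ 𝓝 x, TopologicalSpace.IsSeparable U) → Infinite X →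
      Module.rank 𝕜 (lindelofSupported 𝕜 X) = lindelofNumber X ^ ℵ₀) := by
  obtain ⟨I, p, hp⟩ := hX.exists_isLindelofPartition
  exact ⟨hp.completeSpace_lindelofSupported 𝕜, inferInstance, inferInstance,
    hp.isometricallyIsomorphic_compactSupported 𝕜,
    fun T _ _ _ φ hφ => nonempty_homeomorph_of_bijective
      (ψ := φ.comp (hp.restrictHom 𝕜)) (hφ.comp (hp.bijective_restrictHom 𝕜)),
    hp.lindelofSupported_eq 𝕜, hp.vanishingAtInfinity_subset 𝕜,
    hp.vanishingAtInfinity_ssubset 𝕜, hp.compactSupported_lambdaLindelof_eq 𝕜,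
    hp.countablyCompactSpace_lambdaLindelof 𝕜, hp.not_normalSpace 𝕜,
    fun hsep _ => hp.rank_lindelofSupported 𝕜 hsep⟩

theorem theorem4p6 (𝕜 : Type) [RCLike 𝕜] (X : Type u) [TopologicalSpace X]
    [TopologicalSpace.MetrizableSpace X] (hX : IsLocallyLindelof X) :
    -- `C_𝒫(X)`, a subalgebra of `C_b(X)` with the supremum norm, is complete
    CompleteSpace (lindelofSupported 𝕜 X) ∧
    -- `Y = λ_𝒫 X` is locally compact Hausdorff and `C_𝒫(X)` is isometrically isomorphic to `C_c(Y)`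
    T2Space (lambdaLindelof 𝕜 X) ∧ LocallyCompactSpace (lambdaLindelof 𝕜 X) ∧
    IsometricallyIsomorphic 𝕜 (lindelofSupported 𝕜 X)
      (compactSupported 𝕜 (lambdaLindelof 𝕜 X)) ∧
    -- `Y` is the only such space, up to homeomorphism
    (∀ (T : Type v) [TopologicalSpace T] [T2Space T] [LocallyCompactSpace T],
      IsometricallyIsomorphic 𝕜 (lindelofSupported 𝕜 X) (compactSupported 𝕜 T) →
        Nonempty (T ≃ₜ lambdaLindelof 𝕜 X)) ∧
    -- `C_𝒫(X)` consists of the functions with Lindelöf support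
    (lindelofSupported 𝕜 X : Set (X →ᵇ 𝕜)) =
      {f : X →ᵇ 𝕜 | IsLindelof (tsupport f)} ∧
    -- it contains `C_0(X)`, properly if `X` is not Lindelöf
    vanishingAtInfinity 𝕜 X ⊆ (lindelofSupported 𝕜 X : Set (X →ᵇ 𝕜)) ∧
    (¬ LindelofSpace X →
      vanishingAtInfinity 𝕜 X ⊂ (lindelofSupported 𝕜 X : Set (X →ᵇ 𝕜))) ∧
    -- `C_c(Y) = C_0(Y)`
    (compactSupported 𝕜 (lambdaLindelof 𝕜 X) : Set (lambdaLindelof 𝕜 X →ᵇ 𝕜)) =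
      vanishingAtInfinity 𝕜 (lambdaLindelof 𝕜 X) ∧
    -- `Y` is countably compact
    CountablyCompactSpace (lambdaLindelof 𝕜 X) ∧
    -- `Y` is not normal if `X` is not Lindelöf
    (¬ LindelofSpace X → ¬ NormalSpace (lambdaLindelof 𝕜 X)) ∧
    -- the dimension (a Hamel dimension, as a cardinal); finite `X` is excluded
    (Infinite X → Module.rank 𝕜 (lindelofSupported 𝕜 X) = lindelofNumber X ^ ℵ₀) := by
  let _ := TopologicalSpace.metrizableSpaceMetric X
  obtain ⟨hcomplete, hT2, hloc, hiso, huniq, hsupp, hsub, hssub, hcc, hcount, hnormal, hrank⟩ :=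
    theorem4p6_general 𝕜 X hX
  exact ⟨hcomplete, hT2, hloc, hiso, fun T _ _ _ ⟨φ, hφ, _⟩ => huniq T φ hφ, hsupp, hsub, hssub,
    hcc, hcount, hnormal, hrank hX.exists_mem_nhds_isSeparable⟩
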